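/- Let $d\in\mathbb{N}$ and let $\mathbf{x}=(x_1,\dots,x_d)$ be a random vector with independent components; suppose each $x_j$ has distribution function $F_j$ and a (measurable, nonnegative) density $f_j$ with respect to Lebesgue measure. Let $f:\mathbb{R}^d\to\mathbb{R}$ be square-integrable under the law of $\mathbf{x}$, with $\sigma^2=\mathrm{Var}(f(\mathbf{x}))>0$, and suppose that all first-order partial derivatives of $f$ exist (are finite) at every point of the box $\{x\in\mathbb{R}^d : 0<F_k(x_k)<1 \text{ for all } k\}$ and are square-integrable under the law of $\mathbf{x}$. Let $f=\sum_{u\subseteq\{1,\dots,d\}}f_u$ be the ANOVA decomposition of $f$, i.e. recursively $f_u(x)=\mathbb{E}\big[f(x^u,\mathbf{x}^{-u})\big]-\sum_{v\subsetneq u}f_v(x)$, where $(x^u,\mathbf{x}^{-u})$ has the coordinates of $x$ in $u$ and those of $\mathbf{x}$ outside $u$. Put $\sigma_u^2=\mathrm{Var}(f_u(\mathbf{x}))$. The total Sobol' index of the $i$th variable is $\overline{S}_i=\frac{1}{\sigma^2}\sum_{v\ni i}\sigma_v^2$. Let $C=\mathbb{E}[\nabla f(\mathbf{x})\nabla f(\mathbf{x})^T]$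 and let $C=W\Lambda W^T$ be any eigendecomposition with $W=(w_{ij})$ orthogonal and $\Lambda=\mathrm{diag}(\lambda_1,\dots,\lambda_d)$, $\lambda_1\ge\dots\ge\lambda_d$. For $1\le i\le d$ and $0\le m\le d$ let $\alpha_i(m)=\sum_{j=1}^m\lambda_j w_{ij}^2$ be the activity score, and set $\lambda_{d+1}=0$. Let $$D(F_i)=4\left[\sup_{x\in\mathbb{R}}\frac{\min(F_i(x),1-F_i(x))}{f_i(x)}\right]^2\in[0,\infty],$$ where $0/0=0$ and $a/0=\infty$ for $a>0$. If $D(F_i)<\infty$, then $$\overline{S}_i\le D(F_i)\,\frac{\alpha_i(m)+\lambda_{m+1}}{\sigma^2}.$$ -/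

import Mathlib

open MeasureTheory ProbabilityTheory
open scoped ENNReal

namespace Sensitivity

noncomputable section

variable {d : ℕ}

/-- The joint law on `ℝ^d` of the random vector `X = (X_1, …, X_d)`. -/
def jointLaw {Ω : Type*} [MeasurableSpace Ω] (P : Measure Ω) (X : Fin d → Ω → ℝ) :
    Measure (Fin d → ℝ) :=
  P.map (fun ω j => X j ω)

/-- `HasMarginalDensity P Y p`: the random variable `Y` has the probability density `p` with
respect to Lebesgue measure. -/
structure HasMarginalDensity {Ω : Type*} [MeasurableSpace Ω] (P : Measure Ω) (Y : Ω → ℝ)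
    (p : ℝ → ℝ) : Prop where
  measurable : Measurable p
  nonneg : ∀ x, 0 ≤ p x
  map_eq : P.map Y = volume.withDensity (fun x => ENNReal.ofReal (p x))

/-- The component `f_u` of the ANOVA decomposition of `f` under the law `ν` with independent
coordinates, given recursively by
`f_u(x) = ∫ f(x^u, y^{-u}) dν(y) - ∑_{v ⊊ u} f_v(x)`.
The point `u.piecewise x y` has the coordinates of `x` in `u` and those of `y` outside `u`. -/
def anovaComponent (ν : Measure (Fin d → ℝ)) (f : (Fin d → ℝ) → ℝ) (u : Finset (Fin d)) :
    (Fin d → ℝ) → ℝ := fun x =>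
  (∫ y, f (u.piecewise x y) ∂ν) - ∑ v ∈ u.ssubsets.attach, anovaComponent ν f v.1 x
termination_by u.card
decreasing_by exact Finset.card_lt_card (Finset.mem_ssubsets.1 v.2)

/-- `σ_u²`, the variance of the ANOVA component `f_u`. -/
def anovaVariance (ν : Measure (Fin d → ℝ)) (f : (Fin d → ℝ) → ℝ) (u : Finset (Fin d)) : ℝ :=
  variance (anovaComponent ν f u) ν

/-- The upper (total) Sobol' index of the subset `u`: `(1/σ²) ∑_{v ∩ u ≠ ∅} σ_v²`. -/
def totalSobolIndex (ν : Measure (Fin d → ℝ)) (f : (Fin d → ℝ) → ℝ) (u : Finset (Fin d)) : ℝ :=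
  (∑ v : Finset (Fin d) with (v ∩ u).Nonempty, anovaVariance ν f v) / variance f ν

/-- The partial derivative `∂f/∂x_j` at `x`. -/
def partialDeriv (f : (Fin d → ℝ) → ℝ) (j : Fin d) (x : Fin d → ℝ) : ℝ :=
  deriv (fun t => f (Function.update x j t)) (x j)

/-- `f` has a finite partial derivative `∂f/∂x_j` at `x`. -/
def HasPartialDeriv (f : (Fin d → ℝ) → ℝ) (j : Fin d) (x : Fin d → ℝ) : Prop :=
  DifferentiableAt ℝ (fun t => f (Function.update x j t)) (x j)

/-- The matrix `C = 𝔼[∇f(x) ∇f(x)ᵀ]`. -/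
def gradientMatrix (ν : Measure (Fin d → ℝ)) (f : (Fin d → ℝ) → ℝ) :
    Matrix (Fin d) (Fin d) ℝ :=
  Matrix.of fun j k => ∫ x, partialDeriv f j x * partialDeriv f k x ∂ν

/-- `C = W Λ Wᵀ` with `W` orthogonal and `Λ = diag(l_1, …, l_d)`, `l_1 ≥ … ≥ l_d`. -/
structure IsEigendecomposition (C W : Matrix (Fin d) (Fin d) ℝ) (l : Fin d → ℝ) : Prop where
  orthogonal : W ∈ Matrix.orthogonalGroup (Fin d) ℝ
  antitone : Antitone l
  eq : C = W * Matrix.diagonal l * W.transpose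

/-- The activity score `α_i(m) = ∑_{j ≤ m} l_j w_{ij}²`. In `Fin d` the `j`-th index of the
mathematical numbering is the one with value `j - 1`. -/
def activityScore (W : Matrix (Fin d) (Fin d) ℝ) (l : Fin d → ℝ) (m : ℕ) (i : Fin d) : ℝ :=
  ∑ j : Fin d with j.val < m, l j * W i j ^ 2

/-- `l_{m+1}`, with the convention `l_{d+1} = 0`. -/
def nextEigenvalue (l : Fin d → ℝ) (m : ℕ) : ℝ :=
  if h : m < d then l ⟨m, h⟩ else 0

/-- `D(F) = 4 [sup_x min(F(x), 1 - F(x)) / p(x)]²` as an element of `[0, ∞]`. In `ℝ≥0∞` we have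
`0 / 0 = 0` (so points with `F(x) ∈ {0, 1}` do not contribute) and `a / 0 = ∞` for `a > 0`. -/
def dgsmConst (F p : ℝ → ℝ) : ℝ≥0∞ :=
  4 * (⨆ x : ℝ, ENNReal.ofReal (min (F x) (1 - F x)) / ENNReal.ofReal (p x)) ^ 2

end

end Sensitivity

/-! The part of the variance of `f` that involves the `i`-th variable is at most the mean, over the
other coordinates, of the variance of `f` along `i`-fibres. A one-dimensional Poincaré inequality
with constant `D(F_i)` on each fibre bounds this by `D(F_i) 𝔼[(∂f/∂x_i)²]`. That expectation is
`C_ii = ∑ λ_j w_ij²`; bounding each `λ_j` with `j > m` by `λ_{m+1}` and using that the rows of `W`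
are unit vectors finishes the proof.

The Poincaré inequality (`evariance_le_dgsmConst_mul`) is of Hardy type: subtract the value at a
median, write the square as the integral of its derivative, swap the integrals, and apply
Cauchy–Schwarz. The ANOVA bound (`sum_anovaVariance_le`) rests on
`integral_partialMean_mul_partialMean`: the inner product of two conditional means depends only on
`u ∩ v`. Möbius inversion over subsets transfers this to the components. -/

namespace Sensitivity

/-! ### The Poincaré inequality on the line -/

theorem continuous_cdf_of_nullSingleton (μ : Measure ℝ) [IsProbabilityMeasure μ] [NullSingletonClass μ] :
    Continuous (cdf μ) := by
  refine continuous_iff_continuousAt.2 fun x => continuousAt_iff_continuous_left'_right'.2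
    ⟨?_, ((cdf μ).right_continuous x).mono Set.Ioi_subset_Ici_self⟩
  rw [(monotone_cdf μ).continuousWithinAt_Iio_iff_leftLim_eq]
  have h := (cdf μ).measure_singleton x
  rw [measure_cdf, measure_singleton, eq_comm, ENNReal.ofReal_eq_zero] at h
  exact le_antisymm ((monotone_cdf μ).leftLim_le le_rfl) (by linarith)

theorem exists_cdf_eq_half (μ : Measure ℝ) [IsProbabilityMeasure μ] [NullSingletonClass μ] :
    ∃ m, cdf μ m = 1 / 2 := by
  obtain ⟨a, ha⟩ := ((tendsto_cdf_atBot μ).eventually_lt_const (u := 1 / 2) (by norm_num)).exists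
  obtain ⟨b, hb⟩ := ((tendsto_cdf_atTop μ).eventually_const_lt (u := 1 / 2) (by norm_num)).exists
  exact mem_range_of_exists_le_of_exists_ge (continuous_cdf_of_nullSingleton μ) ⟨a, ha.le⟩ ⟨b, hb.le⟩

theorem ae_cdf_pos (μ : Measure ℝ) [IsProbabilityMeasure μ] : ∀ᵐ x ∂μ, 0 < cdf μ x := by
  have hnull : ∀ y, ¬ 0 < cdf μ y → μ (Set.Iic y) = 0 := fun y hy => by
    rw [← ofReal_cdf, ENNReal.ofReal_eq_zero]; exact not_lt.1 hy
  refine measure_null_of_locally_null _ fun x (hx : ¬ 0 < cdf μ x) => ?_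
  -- Either some null `Iic y` is a neighbourhood of `x`, or `x` is the last zero of the cdf and `Iic
  -- x` contains all of them.
  by_cases h : ∃ y, x < y ∧ ¬ 0 < cdf μ y
  · obtain ⟨y, hxy, hy⟩ := h
    exact ⟨Set.Iic y, mem_nhdsWithin_of_mem_nhds (Iic_mem_nhds hxy), hnull y hy⟩
  · push Not at h
    exact ⟨Set.Iic x, Filter.mem_of_superset self_mem_nhdsWithin
      fun z hz => not_lt.1 fun hxz => hz (h z hxz), hnull x hx⟩

/-- The absence of atoms matters here: the first point where the cdf equals `1` could otherwise
carry mass. -/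
theorem ae_cdf_lt_one (μ : Measure ℝ) [IsProbabilityMeasure μ] [NullSingletonClass μ] :
    ∀ᵐ x ∂μ, cdf μ x < 1 := by
  have hnull : ∀ y, ¬ cdf μ y < 1 → μ (Set.Ici y) = 0 := fun y hy => by
    rw [← Ioi_ae_eq_Ici.measure_eq, ← Set.compl_Iic, prob_compl_eq_zero_iff measurableSet_Iic,
      ← ofReal_cdf, le_antisymm (cdf_le_one μ y) (not_lt.1 hy), ENNReal.ofReal_one]
  refine measure_null_of_locally_null _ fun x (hx : ¬ cdf μ x < 1) => ?_
  by_cases h : ∃ y, y < x ∧ ¬ cdf μ y < 1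
  · obtain ⟨y, hxy, hy⟩ := h
    exact ⟨Set.Ici y, mem_nhdsWithin_of_mem_nhds (Ici_mem_nhds hxy), hnull y hy⟩
  · push Not at h
    exact ⟨Set.Ici x, Filter.mem_of_superset self_mem_nhdsWithin
      fun z hz => not_lt.1 fun hxz => hz (h z hxz), hnull x hx⟩

/-- The fundamental theorem of calculus for the square of a function. -/
theorem enorm_sq_le_lintegral_uIoc {h : ℝ → ℝ} {m x : ℝ} (hm : h m = 0)
    (hd : ∀ t ∈ Set.uIcc m x, DifferentiableAt ℝ h t) :
    ‖h x‖ₑ ^ 2 ≤ ∫⁻ t in Set.uIoc m x, 2 * (‖h t‖ₑ * ‖deriv h t‖ₑ) := by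
  have hcont : ContinuousOn h (Set.uIcc m x) := fun t ht =>
    (hd t ht).continuousAt.continuousWithinAt
  have hsub : Set.uIoc m x ⊆ Set.uIcc m x := Set.uIoc_subset_uIcc
  have hen : ∀ t, ‖2 * (h t * deriv h t)‖ₑ = 2 * (‖h t‖ₑ * ‖deriv h t‖ₑ) := fun t => by
    rw [enorm_mul, enorm_mul]
    congr 1
    simp [Real.enorm_eq_ofReal_abs]
  simp_rw [← hen]
  -- Integrability of `h h'` is not assumed: if it fails, the right-hand side is infinite.
  rcases eq_or_ne (∫⁻ t in Set.uIoc m x, ‖2 * (h t * deriv h t)‖ₑ) ⊤ with htop | htop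
  · rw [htop]; exact le_top
  have hint : IntervalIntegrable (fun t => 2 * (h t * deriv h t)) volume m x := by
    rw [intervalIntegrable_iff]
    refine ⟨?_, lt_top_iff_ne_top.2 htop⟩
    refine (AEStronglyMeasurable.mul ?_ (measurable_deriv h).aestronglyMeasurable).const_mul 2
    exact (hcont.mono hsub).aestronglyMeasurable measurableSet_uIoc
  have key := intervalIntegral.integral_eq_sub_of_hasDerivAt (f := fun t => h t ^ 2)
    (f' := fun t => 2 * (h t * deriv h t)) (fun t ht =>
      ((hd t ht).hasDerivAt.fun_pow 2).congr_deriv (by simp [mul_assoc])) hint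
  have hx : h x ^ 2 = ∫ t in m..x, 2 * (h t * deriv h t) := by rw [key, hm]; ring
  rw [← enorm_pow, hx, Real.enorm_eq_ofReal_abs,
    intervalIntegral.abs_integral_eq_abs_integral_uIoc, ← Real.enorm_eq_ofReal_abs]
  exact enorm_integral_le_lintegral_enorm _

theorem lintegral_mul_enorm_sq_le {α : Type*} [MeasurableSpace α] (μ : Measure α)
    {a b : α → ℝ≥0∞} (ha : AEMeasurable a μ) (hb : AEMeasurable b μ) :
    (∫⁻ x, a x * b x ∂μ) ^ 2 ≤ (∫⁻ x, a x ^ 2 ∂μ) * ∫⁻ x, b x ^ 2 ∂μ := by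
  have h := ENNReal.lintegral_mul_le_Lp_mul_Lq μ Real.HolderConjugate.two_two ha hb
  calc (∫⁻ x, a x * b x ∂μ) ^ 2
      ≤ ((∫⁻ x, a x ^ (2 : ℝ) ∂μ) ^ (1 / 2 : ℝ) * (∫⁻ x, b x ^ (2 : ℝ) ∂μ) ^ (1 / 2 : ℝ)) ^ 2 := by
        gcongr; exact h
    _ = _ := by
        rw [mul_pow, ← ENNReal.rpow_natCast, ← ENNReal.rpow_natCast, ← ENNReal.rpow_mul,
          ← ENNReal.rpow_mul]
        simp

/-- A Hardy-type inequality on the two half-lines issuing from a point `m` of the support: it is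
stated for a density `p` with respect to which the tails away from `m` are dominated. -/
theorem lintegral_enorm_sq_le {p : ℝ → ℝ≥0∞} (hp : Measurable p) (μ : Measure ℝ)
    [IsFiniteMeasure μ] (hμ : μ = volume.withDensity p) {I : Set ℝ} (hI : I.OrdConnected)
    (hIae : ∀ᵐ x ∂μ, x ∈ I) {m : ℝ} (hmI : m ∈ I) {K : ℝ≥0∞}
    (hK : ∀ t, μ {x | t ∈ Set.uIoc m x} ≤ K * p t) {h : ℝ → ℝ} (hm : h m = 0)
    (hd : ∀ t ∈ I, DifferentiableAt ℝ h t) (hfin : ∫⁻ x, ‖h x‖ₑ ^ 2 ∂μ ≠ ⊤) :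
    ∫⁻ x, ‖h x‖ₑ ^ 2 ∂μ ≤ 4 * K ^ 2 * ∫⁻ x, ‖deriv h x‖ₑ ^ 2 ∂μ := by
  classical
  -- `h` is controlled only on `I`; this modification is Borel on the whole line and agrees with `h`
  -- almost everywhere.
  set h' : ℝ → ℝ := I.piecewise h 0
  have hImeas : MeasurableSet I := hI.measurableSet
  have hcont : ContinuousOn h I := fun t ht => (hd t ht).continuousAt.continuousWithinAt
  have hmeas : Measurable h' := hcont.measurable_piecewise continuousOn_const hImeas
  have heq : ∀ t ∈ I, h' t = h t := fun t ht => Set.piecewise_eq_of_mem _ _ _ ht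
  set φ : ℝ → ℝ≥0∞ := fun t => 2 * (‖h' t‖ₑ * ‖deriv h t‖ₑ) with hφ
  have hφm : Measurable φ :=
    (hmeas.enorm.mul (measurable_deriv h).enorm).const_mul 2
  have hset : MeasurableSet {q : ℝ × ℝ | q.2 ∈ Set.uIoc m q.1} := by
    simp only [Set.mem_uIoc]
    exact ((measurableSet_lt measurable_const measurable_snd).inter
      (measurableSet_le measurable_snd measurable_fst)).union
      ((measurableSet_lt measurable_fst measurable_snd).inter
      (measurableSet_le measurable_snd measurable_const))
  have step1 : ∫⁻ x, ‖h x‖ₑ ^ 2 ∂μ ≤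
      ∫⁻ x, (∫⁻ t, {q : ℝ × ℝ | q.2 ∈ Set.uIoc m q.1}.indicator (fun q => φ q.2) (x, t)) ∂μ := by
    refine lintegral_mono_ae (hIae.mono fun x hx => ?_)
    have hsub : Set.uIcc m x ⊆ I := hI.uIcc_subset hmI hx
    refine (enorm_sq_le_lintegral_uIoc hm fun t ht => hd t (hsub ht)).trans ?_
    rw [← lintegral_indicator measurableSet_uIoc]
    refine lintegral_mono fun t => ?_
    by_cases ht : t ∈ Set.uIoc m x
    · simp [Set.indicator, ht, hφ, heq t (hsub (Set.uIoc_subset_uIcc ht))]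
    · simp [ht]
  -- After Tonelli, the inner integral is the tail mass beyond `t`; its bound `K * p t` turns `dt`
  -- back into `dμ`.
  have step2 : ∫⁻ x, (∫⁻ t, {q : ℝ × ℝ | q.2 ∈ Set.uIoc m q.1}.indicator (fun q => φ q.2) (x, t)) ∂μ
      ≤ 2 * K * ∫⁻ t, ‖h t‖ₑ * ‖deriv h t‖ₑ ∂μ := by
    rw [lintegral_lintegral_swap]
    swap
    · exact ((hφm.comp measurable_snd).indicator hset).aemeasurable
    have : ∀ t, ∫⁻ x, {q : ℝ × ℝ | q.2 ∈ Set.uIoc m q.1}.indicator (fun q => φ q.2) (x, t) ∂μ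
        = φ t * μ {x | t ∈ Set.uIoc m x} := fun t => by
      exact lintegral_indicator_const (measurable_prodMk_right hset : MeasurableSet
        {x | t ∈ Set.uIoc m x}) (φ t)
    simp_rw [this]
    calc ∫⁻ t, φ t * μ {x | t ∈ Set.uIoc m x}
        ≤ ∫⁻ t, K * (p * φ) t := lintegral_mono fun t => by
          refine (mul_le_mul_right (hK t) (φ t)).trans_eq ?_
          change φ t * (K * p t) = K * (p t * φ t); ring
      _ = K * ∫⁻ t, φ t ∂μ := by
          rw [lintegral_const_mul _ (hp.mul hφm), hμ, lintegral_withDensity_eq_lintegral_mul _ hp hφm]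
      _ = K * ∫⁻ t, 2 * (‖h t‖ₑ * ‖deriv h t‖ₑ) ∂μ := by
          congr 1
          exact lintegral_congr_ae (hIae.mono fun t ht => by simp [hφ, heq t ht])
      _ = _ := by
          rw [lintegral_const_mul' _ _ (by simp)]; ring
  set A := ∫⁻ x, ‖h x‖ₑ ^ 2 ∂μ
  set B := ∫⁻ x, ‖deriv h x‖ₑ ^ 2 ∂μ
  have hae : AEMeasurable h μ := ⟨h', hmeas, hIae.mono fun t ht => (heq t ht).symm⟩
  have step3 : A * A ≤ A * (4 * K ^ 2 * B) := by
    calc A * A = A ^ 2 := (sq A).symm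
      _ ≤ (2 * K * ∫⁻ t, ‖h t‖ₑ * ‖deriv h t‖ₑ ∂μ) ^ 2 := by gcongr; exact step1.trans step2
      _ = 4 * K ^ 2 * (∫⁻ t, ‖h t‖ₑ * ‖deriv h t‖ₑ ∂μ) ^ 2 := by ring
      _ ≤ 4 * K ^ 2 * (A * B) := by
        gcongr
        exact lintegral_mul_enorm_sq_le μ hae.enorm (measurable_deriv h).aemeasurable.enorm
      _ = _ := by ring
  -- Cancelling `A` is where its finiteness is needed.
  rcases eq_or_ne A 0 with h0 | h0
  · rw [h0]; exact zero_le
  · exact (ENNReal.mul_le_mul_iff_right h0 hfin).1 step3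

theorem lintegral_enorm_sq_eq_ofReal {α : Type*} [MeasurableSpace α] {ν : Measure α} {g : α → ℝ}
    (hg : MemLp g 2 ν) : ∫⁻ x, ‖g x‖ₑ ^ 2 ∂ν = ENNReal.ofReal (∫ x, g x ^ 2 ∂ν) := by
  rw [ofReal_integral_eq_lintegral_ofReal hg.integrable_sq (.of_forall fun x => sq_nonneg _)]
  refine lintegral_congr fun x => ?_
  rw [Real.enorm_eq_ofReal_abs, ← ENNReal.ofReal_pow (abs_nonneg _), sq_abs]

theorem evariance_le_lintegral_sub_sq {α : Type*} [MeasurableSpace α] (μ : Measure α)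
    [IsProbabilityMeasure μ] {g : α → ℝ} (hg : MemLp g 2 μ) (c : ℝ) :
    evariance g μ ≤ ∫⁻ x, ‖g x - c‖ₑ ^ 2 ∂μ := by
  have hgc : MemLp (fun x => g x - c) 2 μ := hg.sub (memLp_const c)
  rw [← ofReal_variance hg, ← variance_sub_const hg.1 c]
  refine (ENNReal.ofReal_le_ofReal (variance_le_expectation_sq hgc.1)).trans_eq
    (lintegral_enorm_sq_eq_ofReal hgc).symm

/-- A weighted Poincaré inequality on the line. -/
theorem evariance_le_dgsmConst_mul (μ : Measure ℝ) [IsProbabilityMeasure μ] {p : ℝ → ℝ}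
    (hp : Measurable p) (hμ : μ = volume.withDensity fun x => ENNReal.ofReal (p x))
    (hD : dgsmConst (cdf μ) p ≠ ⊤) {g : ℝ → ℝ} (hg : MemLp g 2 μ)
    (hd : ∀ t, 0 < cdf μ t → cdf μ t < 1 → DifferentiableAt ℝ g t) :
    evariance g μ ≤ dgsmConst (cdf μ) p * ∫⁻ x, ‖deriv g x‖ₑ ^ 2 ∂μ := by
  have : NullSingletonClass μ := by rw [hμ]; infer_instance
  set K := ⨆ x : ℝ, ENNReal.ofReal (min (cdf μ x) (1 - cdf μ x)) / ENNReal.ofReal (p x)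
  have hDK : dgsmConst (cdf μ) p = 4 * K ^ 2 := rfl
  have hKtop : K ≠ ⊤ := fun h => hD (by rw [hDK, h]; simp)
  -- At a median, the tail away from `m` is always the smaller one: `1 - F` to the right and `F` to
  -- the left.
  obtain ⟨m, hm⟩ := exists_cdf_eq_half μ
  have hmin : ∀ t, ENNReal.ofReal (min (cdf μ t) (1 - cdf μ t)) ≤ K * ENNReal.ofReal (p t) :=
    fun t => by
      have h : ENNReal.ofReal (min (cdf μ t) (1 - cdf μ t)) / ENNReal.ofReal (p t) ≤ K :=
        le_iSup (fun x => ENNReal.ofReal (min (cdf μ x) (1 - cdf μ x)) / ENNReal.ofReal (p x)) t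
      -- Where the density vanishes, finiteness of `K` forces the numerator to vanish too, since `a
      -- / 0 = ∞` for `a > 0`.
      rcases eq_or_ne (ENNReal.ofReal (p t)) 0 with h0 | h0
      · by_contra hne
        rw [h0, ENNReal.div_zero (fun h1 => hne (by rw [h1]; exact zero_le))] at h
        exact hKtop (top_le_iff.1 h)
      · exact (ENNReal.div_le_iff h0 ENNReal.ofReal_ne_top).1 h
  have hK : ∀ t, μ {x | t ∈ Set.uIoc m x} ≤ K * ENNReal.ofReal (p t) := fun t => by
    refine le_trans ?_ (hmin t)
    have hIic : μ (Set.Iic t) = ENNReal.ofReal (cdf μ t) := (ofReal_cdf μ t).symm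
    rcases lt_or_ge m t with hmt | hmt
    · have hset : {x | t ∈ Set.uIoc m x} ⊆ Set.Ici t := fun x hx => by
        rcases Set.mem_uIoc.1 hx with h | h
        · exact h.2
        · exact absurd h.2 hmt.not_ge
      have h2 : (1 : ℝ) / 2 ≤ cdf μ t := hm ▸ monotone_cdf μ hmt.le
      rw [min_eq_right (by linarith)]
      refine (measure_mono hset).trans_eq ?_
      rw [← Ioi_ae_eq_Ici.measure_eq, ← Set.compl_Iic, prob_compl_eq_one_sub measurableSet_Iic,
        hIic, ENNReal.ofReal_sub _ (cdf_nonneg μ t), ENNReal.ofReal_one]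
    · have hset : {x | t ∈ Set.uIoc m x} ⊆ Set.Iic t := fun x hx => by
        rcases Set.mem_uIoc.1 hx with h | h
        · exact absurd h.1 hmt.not_gt
        · exact h.1.le
      have h2 : cdf μ t ≤ 1 / 2 := hm ▸ monotone_cdf μ hmt
      rw [min_eq_left (by linarith), ← hIic]
      exact measure_mono hset
  have hI : {t | 0 < cdf μ t ∧ cdf μ t < 1}.OrdConnected := ⟨fun a ha b hb t ht =>
    ⟨ha.1.trans_le (monotone_cdf μ ht.1), (monotone_cdf μ ht.2).trans_lt hb.2⟩⟩
  have hder : deriv (fun x => g x - g m) = deriv g := by ext t; simp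
  have key := lintegral_enorm_sq_le hp.ennreal_ofReal μ hμ hI
    ((ae_cdf_pos μ).and (ae_cdf_lt_one μ)) (m := m) (by simp only [Set.mem_ofPred_eq, hm]; norm_num)
    hK (h := fun x => g x - g m) (sub_self _) (fun t ht => (hd t ht.1 ht.2).sub_const _) ?_
  · rw [hder] at key
    exact (evariance_le_lintegral_sub_sq μ hg (g m)).trans key
  · have hgc : MemLp (fun x => g x - g m) 2 μ := hg.sub (memLp_const _)
    rw [lintegral_enorm_sq_eq_ofReal hgc]
    exact ENNReal.ofReal_ne_top

/-! ### ANOVA components by Möbius inversion -/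

/-- The conditional mean `x ↦ 𝔼[f(x^u, X^{-u})]` of `f` given the coordinates in `u`. -/
noncomputable def partialMean {d : ℕ} (ν : Measure (Fin d → ℝ)) (f : (Fin d → ℝ) → ℝ)
    (u : Finset (Fin d)) : (Fin d → ℝ) → ℝ := fun x => ∫ y, f (u.piecewise x y) ∂ν

theorem sum_powerset_anovaComponent {d : ℕ} (ν : Measure (Fin d → ℝ)) (f : (Fin d → ℝ) → ℝ)
    (u : Finset (Fin d)) (x : Fin d → ℝ) :
    ∑ v ∈ u.powerset, anovaComponent ν f v x = partialMean ν f u x := by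
  rw [← Finset.sum_erase_add _ _ (Finset.mem_powerset_self u), anovaComponent,
    Finset.sum_attach u.ssubsets fun v => anovaComponent ν f v x]
  exact add_sub_cancel _ _

theorem partialMean_univ {d : ℕ} (ν : Measure (Fin d → ℝ)) [IsProbabilityMeasure ν]
    (f : (Fin d → ℝ) → ℝ) : partialMean ν f Finset.univ = f := by
  ext x; simp [partialMean]

/-- Uniqueness in Möbius inversion: identities for components may be checked on conditional means.
-/
theorem eq_of_sum_powerset_eq {α M : Type*} [DecidableEq α] [AddCommGroup M] {φ ψ : Finset α → M}
    (h : ∀ u : Finset α, ∑ v ∈ u.powerset, φ v = ∑ v ∈ u.powerset, ψ v) (u : Finset α) :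
    φ u = ψ u := by
  induction u using Finset.strongInduction with
  | H u ih =>
    have hu := h u
    have hss : ∑ v ∈ u.powerset.erase u, φ v = ∑ v ∈ u.powerset.erase u, ψ v :=
      Finset.sum_congr rfl fun v hv => ih v (Finset.mem_ssubsets.1 hv)
    rw [← Finset.sum_erase_add _ _ (Finset.mem_powerset_self u),
      ← Finset.sum_erase_add _ _ (Finset.mem_powerset_self u), hss] at hu
    exact add_left_cancel hu

/-! ### Orthogonality of the ANOVA decomposition -/

section Product

variable {d : ℕ} (μ : Fin d → Measure ℝ) [∀ j, IsProbabilityMeasure (μ j)]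

theorem measurable_piecewise_prod (u : Finset (Fin d)) :
    Measurable fun q : (Fin d → ℝ) × (Fin d → ℝ) => u.piecewise q.1 q.2 := by
  refine measurable_pi_lambda _ fun k => ?_
  by_cases hk : k ∈ u
  · simpa [hk] using measurable_fst.eval
  · simpa [hk] using measurable_snd.eval

theorem measurePreserving_piecewise (u : Finset (Fin d)) :
    MeasurePreserving (fun q : (Fin d → ℝ) × (Fin d → ℝ) => u.piecewise q.1 q.2)
      ((Measure.pi μ).prod (Measure.pi μ)) (Measure.pi μ) := by
  have h1 : MeasurePreserving (fun (ω : Fin d → ℝ × ℝ) k => if k ∈ u then (ω k).1 else (ω k).2)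
      (Measure.pi fun k => (μ k).prod (μ k)) (Measure.pi μ) :=
    measurePreserving_pi (f := fun k (q : ℝ × ℝ) => if k ∈ u then q.1 else q.2) _ _ fun k => by
      by_cases hk : k ∈ u
      · simpa [hk] using measurePreserving_fst
      · simpa [hk] using measurePreserving_snd
  exact h1.comp (measurePreserving_arrowProdEquivProdArrow ℝ ℝ (Fin d) μ μ).symm

/-- Two copies of the random vector which share the coordinates in `u ∩ v`. -/
def coupledPair (u v : Finset (Fin d)) (q : (Fin d → ℝ) × (Fin d → ℝ) × (Fin d → ℝ)) :
    (Fin d → ℝ) × (Fin d → ℝ) := (u.piecewise q.1 q.2.1, v.piecewise q.1 q.2.2)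

theorem measurable_coupledPair (u v : Finset (Fin d)) : Measurable (coupledPair u v) :=
  ((measurable_piecewise_prod u).comp (measurable_fst.prodMk measurable_snd.fst)).prodMk
    ((measurable_piecewise_prod v).comp (measurable_fst.prodMk measurable_snd.snd))

/-- In an unshared coordinate the pair reads two different entries of an independent triple, so
which two does not matter. -/
theorem map_coupledPair_coord (m : Measure ℝ) [IsProbabilityMeasure m] (a b : Prop) [Decidable a]
    [Decidable b] (hab : ¬ (a ∧ b)) :
    (m.prod (m.prod m)).map (fun q : ℝ × ℝ × ℝ => (if a then q.1 else q.2.1,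
      if b then q.1 else q.2.2)) = m.prod m := by
  by_cases ha : a
  · have hb : ¬ b := fun hb => hab ⟨ha, hb⟩
    simp only [ha, hb, if_true, if_false]
    exact ((MeasurePreserving.id m).prod (measurePreserving_snd (μ := m) (ν := m))).map_eq
  · by_cases hb : b
    · simp only [ha, hb, if_true, if_false]
      exact ((Measure.measurePreserving_swap (μ := m) (ν := m)).comp
        ((MeasurePreserving.id m).prod (measurePreserving_fst (μ := m) (ν := m)))).map_eq
    · simpa only [ha, hb, if_false] using (measurePreserving_snd (μ := m) (ν := m.prod m)).map_eq

theorem map_coupledPair_eq_inter (u v : Finset (Fin d)) :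
    ((Measure.pi μ).prod ((Measure.pi μ).prod (Measure.pi μ))).map (coupledPair u v) =
      ((Measure.pi μ).prod ((Measure.pi μ).prod (Measure.pi μ))).map
        (coupledPair (u ∩ v) (u ∩ v)) := by
  -- Regroups a family of triples as a triple of families, so that laws can be compared
  -- coordinatewise.
  have hR := ((MeasurePreserving.id (Measure.pi μ)).prod
    (measurePreserving_arrowProdEquivProdArrow ℝ ℝ (Fin d) μ μ)).comp
    (measurePreserving_arrowProdEquivProdArrow ℝ (ℝ × ℝ) (Fin d) μ fun k => (μ k).prod (μ k))
  have hmeas : ∀ (u v : Finset (Fin d)) (k : Fin d), Measurable fun q : ℝ × ℝ × ℝ =>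
      (if k ∈ u then q.1 else q.2.1, if k ∈ v then q.1 else q.2.2) := fun u v k =>
    (Measurable.ite (by simp) measurable_fst measurable_snd.fst).prodMk
      (Measurable.ite (by simp) measurable_fst measurable_snd.snd)
  have key : ∀ u v : Finset (Fin d),
      ((Measure.pi μ).prod ((Measure.pi μ).prod (Measure.pi μ))).map (coupledPair u v) =
      (Measure.pi fun k => ((μ k).prod ((μ k).prod (μ k))).map fun q : ℝ × ℝ × ℝ =>
        (if k ∈ u then q.1 else q.2.1, if k ∈ v then q.1 else q.2.2)).map
        (MeasurableEquiv.arrowProdEquivProdArrow ℝ ℝ (Fin d)) := fun u v => by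
    have : ∀ k, IsProbabilityMeasure (((μ k).prod ((μ k).prod (μ k))).map fun q : ℝ × ℝ × ℝ =>
        (if k ∈ u then q.1 else q.2.1, if k ∈ v then q.1 else q.2.2)) := fun k =>
      Measure.isProbabilityMeasure_map (hmeas u v k).aemeasurable
    have hcoord : Measurable fun (ω : Fin d → ℝ × ℝ × ℝ) k =>
        (if k ∈ u then (ω k).1 else (ω k).2.1, if k ∈ v then (ω k).1 else (ω k).2.2) :=
      measurable_pi_iff.2 fun k => (hmeas u v k).comp (measurable_pi_apply k)
    rw [← hR.map_eq, Measure.map_map (measurable_coupledPair u v) hR.measurable,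
      ← Measure.pi_map_pi fun k => (hmeas u v k).aemeasurable,
      Measure.map_map (MeasurableEquiv.measurable _) hcoord]
    rfl
  rw [key, key]
  congr 2
  ext1 k
  by_cases hk : k ∈ u ∩ v
  · obtain ⟨h1, h2⟩ := Finset.mem_inter.1 hk
    simp [h1, h2]
  · rw [map_coupledPair_coord _ _ _ fun h => hk (Finset.mem_inter.2 h),
      map_coupledPair_coord _ _ _ fun h => hk h.1]

variable {μ} {f : (Fin d → ℝ) → ℝ}

theorem integrable_coupledPair (hf : MemLp f 2 (Measure.pi μ)) (u v : Finset (Fin d)) :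
    Integrable (fun q => f (coupledPair u v q).1 * f (coupledPair u v q).2)
      ((Measure.pi μ).prod ((Measure.pi μ).prod (Measure.pi μ))) := by
  have h1 := hf.comp_measurePreserving ((measurePreserving_piecewise μ u).comp
    ((MeasurePreserving.id (Measure.pi μ)).prod
      (measurePreserving_fst (μ := Measure.pi μ) (ν := Measure.pi μ))))
  have h2 := hf.comp_measurePreserving ((measurePreserving_piecewise μ v).comp
    ((MeasurePreserving.id (Measure.pi μ)).prod
      (measurePreserving_snd (μ := Measure.pi μ) (ν := Measure.pi μ))))
  exact h1.integrable_mul h2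

/-- Given the shared copy, the two fresh copies are independent, so the inner integral factors. -/
theorem integral_coupledPair (hf : MemLp f 2 (Measure.pi μ)) (u v : Finset (Fin d)) :
    ∫ q, f (coupledPair u v q).1 * f (coupledPair u v q).2
      ∂((Measure.pi μ).prod ((Measure.pi μ).prod (Measure.pi μ))) =
    ∫ x, partialMean (Measure.pi μ) f u x * partialMean (Measure.pi μ) f v x ∂(Measure.pi μ) := by
  rw [integral_prod _ (integrable_coupledPair hf u v)]
  exact integral_congr_ae (.of_forall fun x => integral_prod_mul
    (fun y => f (u.piecewise x y)) fun y => f (v.piecewise x y))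

theorem memLp_partialMean (hf : MemLp f 2 (Measure.pi μ)) (u : Finset (Fin d)) :
    MemLp (partialMean (Measure.pi μ) f u) 2 (Measure.pi μ) := by
  refine (memLp_two_iff_integrable_sq ?_).2 ?_
  · exact (hf.comp_measurePreserving (measurePreserving_piecewise μ u)).1.integral_prod_right'
  · refine (integrable_coupledPair hf u u).integral_prod_left.congr (.of_forall fun x => ?_)
    exact (integral_prod_mul (fun y => f (u.piecewise x y)) fun y => f (u.piecewise x y)).trans
      (sq (partialMean (Measure.pi μ) f u x)).symm

theorem memLp_anovaComponent (hf : MemLp f 2 (Measure.pi μ)) (u : Finset (Fin d)) :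
    MemLp (anovaComponent (Measure.pi μ) f u) 2 (Measure.pi μ) := by
  induction u using Finset.strongInduction with
  | H u ih =>
    have h : anovaComponent (Measure.pi μ) f u = fun x => partialMean (Measure.pi μ) f u x -
        ∑ v ∈ u.ssubsets, anovaComponent (Measure.pi μ) f v x := by
      ext x
      rw [anovaComponent, Finset.sum_attach u.ssubsets fun v => anovaComponent _ f v x,
        partialMean]
    rw [h]
    exact (memLp_partialMean hf u).sub
      (memLp_finsetSum _ fun v hv => ih v (Finset.mem_ssubsets.1 hv))

/-- Both sides are integrals of `f ⊗ f` against laws of coupled pairs, and these laws depend only on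
the shared coordinates. -/
theorem integral_partialMean_mul_partialMean (hf : MemLp f 2 (Measure.pi μ)) (u v : Finset (Fin d)) :
    ∫ x, partialMean (Measure.pi μ) f u x * partialMean (Measure.pi μ) f v x ∂(Measure.pi μ) =
      ∫ x, partialMean (Measure.pi μ) f (u ∩ v) x ^ 2 ∂(Measure.pi μ) := by
  have hQ : ∀ u v : Finset (Fin d),
      ∫ q, f (coupledPair u v q).1 * f (coupledPair u v q).2
        ∂((Measure.pi μ).prod ((Measure.pi μ).prod (Measure.pi μ))) =
      ∫ r, f r.1 * f r.2
        ∂(((Measure.pi μ).prod ((Measure.pi μ).prod (Measure.pi μ))).map (coupledPair u v)) :=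
      fun u v => by
    have h1 : MeasurePreserving Prod.fst (((Measure.pi μ).prod ((Measure.pi μ).prod
        (Measure.pi μ))).map (coupledPair u v)) (Measure.pi μ) := by
      refine ⟨measurable_fst, ?_⟩
      rw [Measure.map_map measurable_fst (measurable_coupledPair u v)]
      exact ((measurePreserving_piecewise μ u).comp ((MeasurePreserving.id (Measure.pi μ)).prod
        (measurePreserving_fst (μ := Measure.pi μ) (ν := Measure.pi μ)))).map_eq
    have h2 : MeasurePreserving Prod.snd (((Measure.pi μ).prod ((Measure.pi μ).prod
        (Measure.pi μ))).map (coupledPair u v)) (Measure.pi μ) := by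
      refine ⟨measurable_snd, ?_⟩
      rw [Measure.map_map measurable_snd (measurable_coupledPair u v)]
      exact ((measurePreserving_piecewise μ v).comp ((MeasurePreserving.id (Measure.pi μ)).prod
        (measurePreserving_snd (μ := Measure.pi μ) (ν := Measure.pi μ)))).map_eq
    exact (integral_map (measurable_coupledPair u v).aemeasurable
      ((hf.1.comp_measurePreserving h1).mul (hf.1.comp_measurePreserving h2))).symm
  simp_rw [sq]
  rw [← integral_coupledPair hf, ← integral_coupledPair hf, hQ, hQ, map_coupledPair_eq_inter]

theorem integral_sum_anovaComponent_mul (hf : MemLp f 2 (Measure.pi μ)) (u : Finset (Fin d)) {g : (Fin d → ℝ) → ℝ}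
    (hg : MemLp g 2 (Measure.pi μ)) :
    ∑ v ∈ u.powerset, ∫ x, anovaComponent (Measure.pi μ) f v x * g x ∂(Measure.pi μ) =
      ∫ x, partialMean (Measure.pi μ) f u x * g x ∂(Measure.pi μ) := by
  have hint : ∀ v ∈ u.powerset, Integrable
      (fun x => anovaComponent (Measure.pi μ) f v x * g x) (Measure.pi μ) :=
    fun v _ => (memLp_anovaComponent hf v).integrable_mul hg
  rw [← integral_finsetSum _ hint]
  simp_rw [← Finset.sum_mul, sum_powerset_anovaComponent]

theorem integral_partialMean_mul_self (hf : MemLp f 2 (Measure.pi μ)) (u : Finset (Fin d)) :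
    ∫ x, partialMean (Measure.pi μ) f u x * f x ∂(Measure.pi μ) =
      ∫ x, partialMean (Measure.pi μ) f u x ^ 2 ∂(Measure.pi μ) := by
  have h := integral_partialMean_mul_partialMean hf u Finset.univ
  rwa [partialMean_univ, Finset.inter_univ] at h

/-- Summed over subsets of `u`, both sides become the pairing of `f` with its conditional mean on `u
∩ v`. -/
theorem integral_anovaComponent_mul_partialMean (hf : MemLp f 2 (Measure.pi μ)) (u v : Finset (Fin d)) :
    ∫ x, anovaComponent (Measure.pi μ) f u x * partialMean (Measure.pi μ) f v x ∂(Measure.pi μ) =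
      if u ⊆ v then ∫ x, anovaComponent (Measure.pi μ) f u x * f x ∂(Measure.pi μ) else 0 := by
  refine eq_of_sum_powerset_eq (φ := fun u => ∫ x, anovaComponent (Measure.pi μ) f u x *
    partialMean (Measure.pi μ) f v x ∂(Measure.pi μ)) (ψ := fun u => if u ⊆ v then
    ∫ x, anovaComponent (Measure.pi μ) f u x * f x ∂(Measure.pi μ) else 0) (fun u => ?_) u
  rw [integral_sum_anovaComponent_mul hf u (memLp_partialMean hf v),
    integral_partialMean_mul_partialMean hf, ← integral_partialMean_mul_self hf,
    ← integral_sum_anovaComponent_mul hf _ hf, ← Finset.sum_filter]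
  refine Finset.sum_congr ?_ fun _ _ => rfl
  ext w
  rw [Finset.mem_powerset, Finset.mem_filter, Finset.mem_powerset, Finset.subset_inter_iff]

theorem integral_anovaComponent_sq (hf : MemLp f 2 (Measure.pi μ)) (u : Finset (Fin d)) :
    ∫ x, anovaComponent (Measure.pi μ) f u x ^ 2 ∂(Measure.pi μ) =
      ∫ x, anovaComponent (Measure.pi μ) f u x * f x ∂(Measure.pi μ) := by
  -- A second inversion, now in the other factor, gives orthogonality of distinct components; only
  -- the diagonal case is kept.
  have h := eq_of_sum_powerset_eq (φ := fun v => ∫ x, anovaComponent (Measure.pi μ) f v x *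
    anovaComponent (Measure.pi μ) f u x ∂(Measure.pi μ)) (ψ := fun v => if v = u then
    ∫ x, anovaComponent (Measure.pi μ) f u x * f x ∂(Measure.pi μ) else 0) (fun v => ?_) u
  · simpa [sq] using h
  · rw [integral_sum_anovaComponent_mul hf v (memLp_anovaComponent hf u)]
    simp_rw [mul_comm (partialMean _ _ _ _)]
    rw [integral_anovaComponent_mul_partialMean hf]
    simp

/-- The unnormalised total Sobol' index of the `i`-th variable is at most the mean square of
`f - 𝔼[f | X_{-i}]`. -/
theorem sum_anovaVariance_le (hf : MemLp f 2 (Measure.pi μ)) (i : Fin d) :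
    ∑ v : Finset (Fin d) with (v ∩ {i}).Nonempty, anovaVariance (Measure.pi μ) f v ≤
      ∫ x, (f x - partialMean (Measure.pi μ) f {i}ᶜ x) ^ 2 ∂(Measure.pi μ) := by
  set g := partialMean (Measure.pi μ) f {i}ᶜ
  have hgL : MemLp g 2 (Measure.pi μ) := memLp_partialMean hf _
  have hfilter : (Finset.univ.filter fun v : Finset (Fin d) => (v ∩ {i}).Nonempty) =
      Finset.univ \ ({i}ᶜ : Finset (Fin d)).powerset := by
    ext v
    by_cases hv : i ∈ v <;> simp [hv, Finset.inter_singleton_of_mem,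
      Finset.inter_singleton_of_notMem, Finset.subset_compl_singleton]
  calc ∑ v : Finset (Fin d) with (v ∩ {i}).Nonempty, anovaVariance (Measure.pi μ) f v
      ≤ ∑ v : Finset (Fin d) with (v ∩ {i}).Nonempty,
        ∫ x, anovaComponent (Measure.pi μ) f v x * f x ∂(Measure.pi μ) := by
        -- Bounding variances by second moments avoids proving that components have mean zero.
        refine Finset.sum_le_sum fun v _ => ?_
        rw [← integral_anovaComponent_sq hf]
        exact variance_le_expectation_sq (memLp_anovaComponent hf v).1
    _ = ∫ x, f x ^ 2 ∂(Measure.pi μ) - ∫ x, g x ^ 2 ∂(Measure.pi μ) := by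
        rw [hfilter, Finset.sum_sdiff_eq_sub (Finset.subset_univ _), ← Finset.powerset_univ,
          integral_sum_anovaComponent_mul hf _ hf, integral_sum_anovaComponent_mul hf _ hf,
          integral_partialMean_mul_self hf, integral_partialMean_mul_self hf, partialMean_univ]
    _ = _ := by
        -- Pythagoras: `g` acts as an orthogonal projection of `f`.
        have h1 : ∫ x, g x * f x ∂(Measure.pi μ) = ∫ x, g x ^ 2 ∂(Measure.pi μ) :=
          integral_partialMean_mul_self hf _
        have h2 : ∀ x, (f x - g x) ^ 2 = f x ^ 2 - 2 * (g x * f x) + g x ^ 2 := fun x => by ring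
        have hgf : Integrable (fun x => g x * f x) (Measure.pi μ) := hgL.integrable_mul hf
        simp_rw [h2]
        have hsub : Integrable (fun x => f x ^ 2 - 2 * (g x * f x)) (Measure.pi μ) :=
          hf.integrable_sq.sub (hgf.const_mul 2)
        rw [integral_add hsub hgL.integrable_sq,
          integral_sub hf.integrable_sq (hgf.const_mul 2), integral_const_mul, h1]
        ring

end Product

/-! ### Eigenvalues and activity scores -/

section Eigen

variable {d : ℕ}

theorem IsEigendecomposition.apply_self {C W : Matrix (Fin d) (Fin d) ℝ} {l : Fin d → ℝ}
    (h : IsEigendecomposition C W l) (i : Fin d) : C i i = ∑ j, l j * W i j ^ 2 := by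
  rw [h.eq, Matrix.mul_apply]
  refine Finset.sum_congr rfl fun j _ => ?_
  rw [Matrix.mul_diagonal, Matrix.transpose_apply]
  ring

theorem IsEigendecomposition.sum_sq_row {C W : Matrix (Fin d) (Fin d) ℝ} {l : Fin d → ℝ}
    (h : IsEigendecomposition C W l) (i : Fin d) : ∑ j, W i j ^ 2 = 1 := by
  have h1 := congrFun (congrFun (Matrix.mem_orthogonalGroup_iff (Fin d) ℝ |>.1 h.orthogonal) i) i
  rw [Matrix.mul_apply, Matrix.one_apply_eq] at h1
  rw [← h1]
  exact Finset.sum_congr rfl fun j _ => sq _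

/-- The eigenvalues are the diagonal entries of `Wᵀ C W`. -/
theorem IsEigendecomposition.nonneg {C W : Matrix (Fin d) (Fin d) ℝ} {l : Fin d → ℝ}
    (h : IsEigendecomposition C W l) (hC : C.PosSemidef) (j : Fin d) : 0 ≤ l j := by
  have h1 : W.transpose * W = 1 := Matrix.mem_orthogonalGroup_iff' (Fin d) ℝ |>.1 h.orthogonal
  have h2 : W.transpose * C * W = Matrix.diagonal l := by
    rw [h.eq, show W.transpose * (W * Matrix.diagonal l * W.transpose) * W =
      (W.transpose * W) * Matrix.diagonal l * (W.transpose * W) by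
        simp only [Matrix.mul_assoc], h1, Matrix.one_mul, Matrix.mul_one]
  have h3 := (hC.conjTranspose_mul_mul_same W).diag_nonneg (i := j)
  rwa [Matrix.conjTranspose_eq_transpose_of_trivial, h2, Matrix.diagonal_apply_eq] at h3

/-- A diagonal entry is at most the activity score plus the first neglected eigenvalue. -/
theorem IsEigendecomposition.apply_self_le {C W : Matrix (Fin d) (Fin d) ℝ} {l : Fin d → ℝ}
    (h : IsEigendecomposition C W l) (hC : C.PosSemidef) (i : Fin d) (m : ℕ) :
    C i i ≤ activityScore W l m i + nextEigenvalue l m := by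
  rw [h.apply_self i, activityScore,
    ← Finset.sum_filter_add_sum_filter_not Finset.univ fun j : Fin d => j.val < m]
  gcongr
  have hnn : 0 ≤ nextEigenvalue l m := by
    unfold nextEigenvalue
    split_ifs
    exacts [h.nonneg hC _, le_rfl]
  calc ∑ j : Fin d with ¬ j.val < m, l j * W i j ^ 2
      ≤ ∑ j : Fin d with ¬ j.val < m, nextEigenvalue l m * W i j ^ 2 := by
        refine Finset.sum_le_sum fun j hj => mul_le_mul_of_nonneg_right ?_ (sq_nonneg _)
        -- Such a `j` forces `m < d`, so the default value `0` is not met here.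
        have hj' : m ≤ j.val := not_lt.1 (Finset.mem_filter.1 hj).2
        rw [nextEigenvalue, dif_pos (hj'.trans_lt j.isLt)]
        exact h.antitone hj'
    _ ≤ ∑ j, nextEigenvalue l m * W i j ^ 2 :=
        Finset.sum_le_sum_of_subset_of_nonneg (Finset.filter_subset _ _)
          fun j _ _ => mul_nonneg hnn (sq_nonneg _)
    _ = nextEigenvalue l m := by rw [← Finset.mul_sum, h.sum_sq_row, mul_one]

/-- The quadratic form at `w` is `𝔼[(w · ∇f)²]`. -/
theorem posSemidef_gradientMatrix {ν : Measure (Fin d → ℝ)} {f : (Fin d → ℝ) → ℝ}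
    (hgrad : ∀ j, MemLp (partialDeriv f j) 2 ν) : (gradientMatrix ν f).PosSemidef := by
  have hint : ∀ j k, Integrable (fun x => partialDeriv f j x * partialDeriv f k x) ν :=
    fun j k => (hgrad j).integrable_mul (hgrad k)
  refine Matrix.PosSemidef.of_dotProduct_mulVec_nonneg ?_ fun w => ?_
  · ext j k
    simp [gradientMatrix, mul_comm]
  · have : star w ⬝ᵥ (gradientMatrix ν f).mulVec w =
        ∫ x, (∑ j, w j * partialDeriv f j x) ^ 2 ∂ν := by
      have h1 : ∀ x, (∑ j, w j * partialDeriv f j x) ^ 2 =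
          ∑ j, ∑ k, w j * w k * (partialDeriv f j x * partialDeriv f k x) := fun x => by
        rw [sq, Finset.sum_mul_sum]
        exact Finset.sum_congr rfl fun j _ => Finset.sum_congr rfl fun k _ => by ring
      simp_rw [h1]
      rw [integral_finsetSum _ fun j _ => integrable_finsetSum _ fun k _ =>
        (hint j k).const_mul _]
      simp only [dotProduct, Matrix.mulVec]
      refine Finset.sum_congr rfl fun j _ => ?_
      rw [integral_finsetSum _ fun k _ => (hint j k).const_mul _, Finset.mul_sum]
      refine Finset.sum_congr rfl fun k _ => ?_
      rw [integral_const_mul]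
      simp [gradientMatrix]
      ring
    rw [this]
    exact integral_nonneg fun x => sq_nonneg _

end Eigen

/-! ### Integrating the Poincaré inequality over fibres -/

section Fibre

variable {d : ℕ} {μ : Fin d → Measure ℝ} [∀ j, IsProbabilityMeasure (μ j)]

theorem piecewise_compl_singleton (i : Fin d) (x y : Fin d → ℝ) :
    ({i}ᶜ : Finset (Fin d)).piecewise x y = Function.update x i (y i) := by
  ext k
  by_cases hk : k = i
  · subst hk; simp
  · simp [hk]

variable (μ) in
/-- Redrawing one coordinate independently does not change the law. -/
theorem measurePreserving_update (i : Fin d) :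
    MeasurePreserving (fun q : (Fin d → ℝ) × ℝ => Function.update q.1 i q.2)
      ((Measure.pi μ).prod (μ i)) (Measure.pi μ) := by
  have hm : Measurable fun q : (Fin d → ℝ) × ℝ => Function.update q.1 i q.2 :=
    measurable_pi_iff.2 fun k => by
      by_cases hk : k = i
      · subst hk; simpa using measurable_snd
      · simpa [hk] using measurable_fst.eval
  have hpre := (MeasurePreserving.id (Measure.pi μ)).prod (measurePreserving_eval μ i)
  refine ⟨hm, ?_⟩
  rw [← hpre.map_eq, Measure.map_map hm hpre.measurable]
  refine Eq.trans ?_ (measurePreserving_piecewise μ {i}ᶜ).map_eq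
  congr 1
  ext1 q
  exact (piecewise_compl_singleton i q.1 q.2).symm

theorem lintegral_eq_lintegral_update {H : (Fin d → ℝ) → ℝ≥0∞}
    (hH : AEMeasurable H (Measure.pi μ)) (i : Fin d) :
    ∫⁻ x, H x ∂(Measure.pi μ) =
      ∫⁻ x, ∫⁻ t, H (Function.update x i t) ∂(μ i) ∂(Measure.pi μ) := by
  have hup := measurePreserving_update μ i
  refine Eq.trans ?_ (lintegral_prod _
    (hH.comp_quasiMeasurePreserving hup.quasiMeasurePreserving))
  conv_lhs => rw [← hup.map_eq]
  exact lintegral_map' (by rwa [hup.map_eq]) hup.aemeasurable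

theorem ae_memLp_update {f : (Fin d → ℝ) → ℝ} (hf : MemLp f 2 (Measure.pi μ)) (i : Fin d) :
    ∀ᵐ x ∂(Measure.pi μ), MemLp (fun t => f (Function.update x i t)) 2 (μ i) := by
  have h := hf.comp_measurePreserving (measurePreserving_update μ i)
  filter_upwards [h.1.prodMk_left, h.integrable_sq.prod_right_ae] with x h1 h2
  exact (memLp_two_iff_integrable_sq h1).2 h2

/-- Redrawing coordinate `i` overwrites `t`, so the conditional mean is constant on the fibre and
the fibre integral of the squared difference is a variance. -/
theorem partialMean_compl_singleton_update {f : (Fin d → ℝ) → ℝ} {i : Fin d} {x : Fin d → ℝ}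
    (hx : MemLp (fun t => f (Function.update x i t)) 2 (μ i)) (t : ℝ) :
    partialMean (Measure.pi μ) f {i}ᶜ (Function.update x i t) =
      ∫ s, f (Function.update x i s) ∂(μ i) := by
  simp_rw [partialMean, piecewise_compl_singleton, Function.update_idem]
  have hev := measurePreserving_eval μ i
  conv_rhs => rw [← hev.map_eq]
  exact (integral_map hev.aemeasurable (by rw [hev.map_eq]; exact hx.1)).symm

/-- The one-dimensional Poincaré inequality, integrated over the other coordinates. -/
theorem integral_sub_partialMean_sq_le {p : ℝ → ℝ} {f : (Fin d → ℝ) → ℝ} {i : Fin d}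
    (hp : Measurable p) (hpi : μ i = volume.withDensity fun x => ENNReal.ofReal (p x))
    [∀ j, NullSingletonClass (μ j)]
    (hD : dgsmConst (cdf (μ i)) p ≠ ⊤) (hf : MemLp f 2 (Measure.pi μ))
    (hdiff : ∀ x : Fin d → ℝ, (∀ k, 0 < cdf (μ k) (x k) ∧ cdf (μ k) (x k) < 1) →
      HasPartialDeriv f i x)
    (hgrad : MemLp (partialDeriv f i) 2 (Measure.pi μ)) :
    ∫ x, (f x - partialMean (Measure.pi μ) f {i}ᶜ x) ^ 2 ∂(Measure.pi μ) ≤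
      (dgsmConst (cdf (μ i)) p).toReal * ∫ x, partialDeriv f i x ^ 2 ∂(Measure.pi μ) := by
  set D := dgsmConst (cdf (μ i)) p
  have hL : MemLp (fun x => f x - partialMean (Measure.pi μ) f {i}ᶜ x) 2 (Measure.pi μ) :=
    hf.sub (memLp_partialMean hf _)
  have hbox : ∀ᵐ x ∂(Measure.pi μ), ∀ k, 0 < cdf (μ k) (x k) ∧ cdf (μ k) (x k) < 1 :=
    ae_all_iff.2 fun k => (measurePreserving_eval μ k).quasiMeasurePreserving.ae
      ((ae_cdf_pos (μ k)).and (ae_cdf_lt_one (μ k)))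
  have key : ∫⁻ x, ‖f x - partialMean (Measure.pi μ) f {i}ᶜ x‖ₑ ^ 2 ∂(Measure.pi μ) ≤
      D * ∫⁻ x, ‖partialDeriv f i x‖ₑ ^ 2 ∂(Measure.pi μ) := by
    rw [lintegral_eq_lintegral_update (hL.1.aemeasurable.enorm.pow_const 2) i,
      lintegral_eq_lintegral_update (hgrad.1.aemeasurable.enorm.pow_const 2) i,
      ← lintegral_const_mul' _ _ hD]
    refine lintegral_mono_ae ?_
    filter_upwards [ae_memLp_update hf i, hbox] with x hx hxbox
    simp_rw [partialMean_compl_singleton_update hx, partialDeriv, Function.update_idem,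
      Function.update_self]
    refine evariance_le_dgsmConst_mul (μ i) hp hpi hD hx fun t ht0 ht1 => ?_
    -- The moved point stays in the box: its other coordinates are those of `x`.
    have h := hdiff (Function.update x i t) fun k => by
      by_cases hk : k = i
      · subst hk; simpa using ⟨ht0, ht1⟩
      · simpa [hk] using hxbox k
    simpa only [HasPartialDeriv, Function.update_idem, Function.update_self] using h
  rw [lintegral_enorm_sq_eq_ofReal hL, lintegral_enorm_sq_eq_ofReal hgrad,
    ← ENNReal.ofReal_toReal hD, ← ENNReal.ofReal_mul ENNReal.toReal_nonneg] at key
  exact (ENNReal.ofReal_le_ofReal_iff (mul_nonneg ENNReal.toReal_nonneg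
    (integral_nonneg fun x => sq_nonneg _))).1 key

end Fibre

end Sensitivity

/-! ### The bound on the total Sobol' index -/

theorem mainTheorem2 {Ω : Type*} [MeasurableSpace Ω] (P : Measure Ω) [IsProbabilityMeasure P]
    {d : ℕ} (X : Fin d → Ω → ℝ) (hX : ∀ j, AEMeasurable (X j) P) (hindep : iIndepFun X P)
    (p : Fin d → ℝ → ℝ) (hp : ∀ j, Sensitivity.HasMarginalDensity P (X j) (p j))
    (F : Fin d → ℝ → ℝ) (hF : ∀ j x, F j x = cdf (P.map (X j)) x)
    (f : (Fin d → ℝ) → ℝ)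
    (hf : MemLp f 2 (Sensitivity.jointLaw P X))
    (hσ : 0 < variance f (Sensitivity.jointLaw P X))
    (hdiff : ∀ x : Fin d → ℝ, (∀ k, 0 < F k (x k) ∧ F k (x k) < 1) →
      ∀ j, Sensitivity.HasPartialDeriv f j x)
    (hgrad : ∀ j, MemLp (Sensitivity.partialDeriv f j) 2 (Sensitivity.jointLaw P X))
    (W : Matrix (Fin d) (Fin d) ℝ) (l : Fin d → ℝ)
    (hW : Sensitivity.IsEigendecomposition
      (Sensitivity.gradientMatrix (Sensitivity.jointLaw P X) f) W l)
    (i : Fin d) (m : ℕ) (hm : m ≤ d)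
    (hD : Sensitivity.dgsmConst (F i) (p i) ≠ ⊤) :
    Sensitivity.totalSobolIndex (Sensitivity.jointLaw P X) f {i} ≤
      (Sensitivity.dgsmConst (F i) (p i)).toReal *
        ((Sensitivity.activityScore W l m i + Sensitivity.nextEigenvalue l m) /
          variance f (Sensitivity.jointLaw P X)) := by
  have hprob : ∀ j, IsProbabilityMeasure (P.map (X j)) := fun j =>
    Measure.isProbabilityMeasure_map (hX j)
  have hatom : ∀ j, NullSingletonClass (P.map (X j)) := fun j => by
    rw [(hp j).map_eq]; infer_instance
  have hlaw : Sensitivity.jointLaw P X = Measure.pi fun j => P.map (X j) :=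
    (iIndepFun_iff_map_fun_eq_pi_map hX).1 hindep
  obtain rfl : F = fun j => (cdf (P.map (X j)) : ℝ → ℝ) := funext fun j => funext (hF j)
  have hC := Sensitivity.posSemidef_gradientMatrix hgrad
  have hCii := hW.apply_self_le hC i m
  rw [Sensitivity.totalSobolIndex, ← mul_div_assoc]
  refine div_le_div_of_nonneg_right ?_ hσ.le
  refine le_trans ?_ (mul_le_mul_of_nonneg_left hCii ENNReal.toReal_nonneg)
  simp only [Sensitivity.gradientMatrix, Matrix.of_apply, ← sq]
  rw [hlaw] at hf hgrad ⊢
  exact (Sensitivity.sum_anovaVariance_le hf i).trans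
    (Sensitivity.integral_sub_partialMean_sq_le (hp i).measurable (hp i).map_eq hD hf
      (fun x hx => hdiff x hx i) (hgrad i))
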